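/- **Setting.** Let $V$ be a real vector space of finite dimension $n$, let $\mathrm{PGL}(V)=\mathrm{GL}(V)/\mathbb{R}^\times$, and let $X$ be its Riemannian symmetric space: the space of inner products on $V$ up to positive scaling, with $\mathrm{PGL}(V)$ acting by $(g\cdot b)(v,w)=b(g^{-1}v,g^{-1}w)$. Let $d_X$ be the Riemannian distance of the $\mathrm{PGL}(V)$-invariant Riemannian metric on $X$ whose norm on the tangent vector at $[b]$ represented by a symmetric form $b(S\cdot,\cdot)$ is $\frac12\sqrt{\mathrm{tr}(S_0^2)}$, where $S_0=S-\frac{\mathrm{tr}\,S}{n}\mathrm{id}$. The maximal flats of $X$ are the orbits $A\cdot p\subset X$, where $A\subset\mathrm{PGL}(V)$ is a maximal diagonalizable, connected, abelian subgroup, $p\in X$, and some basis of $V$ both diagonalizes every element of $A$ and is orthonormal for an inner product in the class $p$. Fix an inner product on $V$ and let $o\in X$ be its class. For $g\in\mathrm{PGL}(V)$ the Cartan projection is $\mu(g)=(\log\mu_1(\bar g),\dots,\log\mu_n(\bar g))\in\mathbb{R}^n$, where $\mu_1(\bar g)\ge\dots\ge\mu_n(\bar g)$ are the singular values, for this inner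 product, of a representative $\bar g\in\mathrm{GL}(V)$ of $g$ with $|\det\bar g|=1$. The simple roots are $\alpha_k(x)=x_k-x_{k+1}$ for $k=1,\dots,n-1$; thus $\alpha_k(\mu(g))=\log\frac{\mu_k}{\mu_{k+1}}(g)$. Let $\Gamma$ be a group, let $R\subset\Gamma$ be a finite generating set (not necessarily symmetric), and let $d_R$ be the word metric on $\Gamma$ associated to $R\cup R^{-1}$. A geodesic ray is a sequence $(\eta_i)_{i=0}^\infty$ in $\Gamma$ with $d_R(\eta_i,\eta_j)=|i-j|$ for all $i,j$. It is rooted if $\eta_0=\mathrm{id}$, and, for $S\in\{R,R^{-1}\}$, it is $S$-directed if $\eta_i^{-1}\eta_{i+1}\in S$ for all $i\ge0$. A sequence in $\Gamma$ is escaping if it eventually leaves every finite subset of $\Gamma$. **Theorem.** Let $\rho:\Gamma\to\mathrm{PGL}(V)$ be a homomorphism with the following properties: - There is some $C>0$ such that for every rooted geodesic ray $(\eta_i)_{i=0}^\infty$ in $\Gamma$ that is $R$-directed or $R^{-1}$-directed, there is a maximal flat $\mathbf F\subset X$ with $d_X(\rho(\eta_i)\cdot o,\mathbf F)\le C$ for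 all $i\ge0$. - For every escaping sequence $(\eta_i)_{i=0}^\infty$ in $\Gamma$ such that every $\eta_i$ is a product of elements of $R$, and for every $k=1,\dots,n-1$, $\displaystyle\lim_{i\to\infty}\alpha_k(\mu(\rho(\eta_i)))=\infty$. Then $\rho$ is $R$-directed Anosov: there are constants $\kappa,\kappa'>0$ such that for every rooted geodesic ray $(\eta_i)_{i=0}^\infty$ in $\Gamma$ that is $R$-directed or $R^{-1}$-directed, $$\alpha_k(\mu(\rho(\eta_i)))\ge\kappa i-\kappa'$$ for all $k=1,\dots,n-1$ and all integers $i\ge0$. -/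

import Mathlib

open Filter Module
open scoped Pointwise

namespace DirectedAnosov

noncomputable section

/-! ## Word metric and directed geodesic rays -/

section Words

variable {Γ : Type*} [Group Γ]

/-- The word metric `d_R` of the symmetrised generating set `R ∪ R⁻¹`. -/
def wordDist (R : Set Γ) (x y : Γ) : ℕ :=
  sInf {m : ℕ | ∃ l : List Γ, l.length = m ∧ (∀ γ ∈ l, γ ∈ R ∪ R⁻¹) ∧ l.prod = x⁻¹ * y}

/-- `(η_i)` is a geodesic ray for `d_R`. -/
def IsGeodesicRay (R : Set Γ) (η : ℕ → Γ) : Prop :=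
  ∀ i j : ℕ, wordDist R (η i) (η (i + j)) = j

/-- `(η_i)` is rooted. -/
def IsRooted (η : ℕ → Γ) : Prop := η 0 = 1

/-- `(η_i)` is `S`-directed: every step `η_i⁻¹ η_{i+1}` lies in `S`. -/
def IsDirected (S : Set Γ) (η : ℕ → Γ) : Prop :=
  ∀ i : ℕ, (η i)⁻¹ * η (i + 1) ∈ S

/-- The rooted geodesic rays of `(Γ, d_R)` that are `R`-directed or `R⁻¹`-directed. -/
def IsRootedDirectedRay (R : Set Γ) (η : ℕ → Γ) : Prop :=
  IsGeodesicRay R η ∧ IsRooted η ∧ (IsDirected R η ∨ IsDirected R⁻¹ η)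

/-- `(η_i)` is escaping: it eventually leaves every finite subset of `Γ`. -/
def IsEscaping (η : ℕ → Γ) : Prop := Tendsto η atTop cofinite

end Words

/-! ## The group `PGL(V)` -/

section PGL

variable (V : Type*) [AddCommGroup V] [Module ℝ V]

/-- The general linear group of `V`. -/
abbrev GLin : Type _ := LinearMap.GeneralLinearGroup ℝ V

/-- The subgroup of non-zero scalar maps. -/
def scalars : Subgroup (GLin V) :=
  (Units.map (algebraMap ℝ (Module.End ℝ V)).toMonoidHom).range

theorem mem_scalars {g : GLin V} : g ∈ scalars V ↔ ∃ c : ℝˣ, ∀ v : V, g.val v = (c : ℝ) • v := by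
  constructor
  · rintro ⟨c, rfl⟩
    exact ⟨c, fun v => rfl⟩
  · rintro ⟨c, hc⟩
    exact ⟨c, Units.ext (LinearMap.ext fun v => (hc v).symm)⟩

instance scalars_normal : (scalars V).Normal := by
  constructor
  rintro _ ⟨c, rfl⟩ g
  refine ⟨c, ?_⟩
  rw [eq_mul_inv_iff_mul_eq]
  exact Units.ext (Algebra.commutes (c : ℝ) g.val)

/-- The projective general linear group `GL(V) / ℝˣ`. -/
abbrev PGLin : Type _ := GLin V ⧸ scalars V

/-- The Lie group topology of `PGL(V)`: the quotient topology of the topology that `GL(V)` has as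
an (open) subset of the finite-dimensional real vector space `End(V)`. -/
@[reducible] def pglTopology : TopologicalSpace (PGLin V) :=
  TopologicalSpace.coinduced (QuotientGroup.mk : GLin V → PGLin V)
    (TopologicalSpace.induced (Units.val : GLin V → Module.End ℝ V)
      (moduleTopology ℝ (Module.End ℝ V)))

variable {V}

/-- Every element of `PGL(V)` has a representative with `|det| = 1`. -/
theorem exists_unimodular [FiniteDimensional ℝ V] (g : PGLin V) :
    ∃ ĝ : GLin V, (QuotientGroup.mk ĝ : PGLin V) = g ∧ |LinearMap.det ĝ.val| = 1 := by
  induction g using QuotientGroup.induction_on with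
  | H g =>
  have hdet : LinearMap.det g.val ≠ 0 := (g.isUnit.map LinearMap.det).ne_zero
  set d := |LinearMap.det g.val| with hd
  have hd0 : 0 < d := abs_pos.2 hdet
  by_cases hn : finrank ℝ V = 0
  · refine ⟨g, rfl, ?_⟩
    rw [LinearMap.det_eq_one_of_finrank_eq_zero hn, abs_one]
  · have hc : 0 < d ^ (-(1 / (finrank ℝ V : ℝ))) := Real.rpow_pos_of_pos hd0 _
    refine ⟨g * Units.map (algebraMap ℝ (Module.End ℝ V)).toMonoidHom (Units.mk0 _ hc.ne'),
      QuotientGroup.mk_mul_of_mem _ ⟨_, rfl⟩, ?_⟩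
    have h1 : (g * Units.map (algebraMap ℝ (Module.End ℝ V)).toMonoidHom
        (Units.mk0 _ hc.ne')).val = (d ^ (-(1 / (finrank ℝ V : ℝ)))) • g.val := by
      ext v
      change g.val ((d ^ (-(1 / (finrank ℝ V : ℝ)))) • v) = _
      simp
    rw [h1, LinearMap.det_smul, abs_mul, ← hd, abs_pow, abs_of_pos hc, ← Real.rpow_natCast,
      ← Real.rpow_mul hd0.le]
    have : -(1 / (finrank ℝ V : ℝ)) * (finrank ℝ V : ℝ) = -1 := by
      have : (finrank ℝ V : ℝ) ≠ 0 := by exact_mod_cast hn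
      field_simp
    rw [this, Real.rpow_neg_one, inv_mul_cancel₀ hd0.ne']

/-- A representative of `g` in `GL(V)` with `|det| = 1`; it is unique up to sign. -/
def unimodularRep [FiniteDimensional ℝ V] (g : PGLin V) : GLin V := (exists_unimodular g).choose

end PGL

/-! ## The symmetric space: inner products up to scaling -/

section SymmetricSpace

variable (V : Type*) [AddCommGroup V] [Module ℝ V]

/-- An inner product on `V`: a symmetric positive definite bilinear form. -/
structure InnerProd where
  /-- the underlying bilinear form -/
  form : LinearMap.BilinForm ℝ V
  symm : ∀ v w, form v w = form w v
  pos : ∀ v, v ≠ 0 → 0 < form v v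

variable {V}

@[ext] theorem InnerProd.ext {b c : InnerProd V} (h : ∀ v w, b.form v w = c.form v w) : b = c := by
  cases b; cases c
  congr
  exact LinearMap.ext₂ h

theorem InnerProd.nondegenerate (b : InnerProd V) : b.form.Nondegenerate := by
  constructor
  · intro v hv
    by_contra h
    exact (b.pos v h).ne' (hv v)
  · intro v hv
    by_contra h
    exact (b.pos v h).ne' (hv v)

/-- `GL(V)` acts on inner products by `(g • b)(v, w) = b(g⁻¹ v, g⁻¹ w)`. -/
instance : MulAction (GLin V) (InnerProd V) where
  smul g b :=
    { form := b.form.compl₁₂ (g⁻¹).val (g⁻¹).val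
      symm := fun v w => b.symm _ _
      pos := fun v hv => b.pos _ fun h => hv (by
        have : g.val ((g⁻¹).val v) = v := by
          rw [← Module.End.mul_apply, ← Units.val_mul, mul_inv_cancel]; rfl
        rw [← this, h, map_zero]) }
  one_smul b := by
    apply InnerProd.ext; intro v w
    change b.form ((1 : GLin V)⁻¹.val v) ((1 : GLin V)⁻¹.val w) = _
    rw [inv_one]; rfl
  mul_smul g h b := by
    apply InnerProd.ext; intro v w
    change b.form ((g * h)⁻¹.val v) ((g * h)⁻¹.val w) = _
    rw [mul_inv_rev]; rfl

theorem InnerProd.smul_form (g : GLin V) (b : InnerProd V) (v w : V) :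
    (g • b).form v w = b.form ((g⁻¹).val v) ((g⁻¹).val w) := rfl

variable (V) in
/-- Two inner products are equivalent when they are (positive) multiples of each other. -/
instance scaling : Setoid (InnerProd V) where
  r b c := ∃ t : ℝ, 0 < t ∧ ∀ v w, c.form v w = t * b.form v w
  iseqv :=
    { refl := fun b => ⟨1, one_pos, fun v w => (one_mul _).symm⟩
      symm := by
        rintro b c ⟨t, ht, h⟩
        exact ⟨t⁻¹, inv_pos.2 ht, fun v w => by rw [h, inv_mul_cancel_left₀ ht.ne']⟩
      trans := by
        rintro b c d ⟨t, ht, h⟩ ⟨s, hs, k⟩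
        exact ⟨s * t, mul_pos hs ht, fun v w => by rw [k, h, mul_assoc]⟩ }

variable (V) in
/-- The symmetric space `X` of `PGL(V)`: inner products on `V` up to scaling. -/
def X : Type _ := Quotient (scaling V)

/-- The point of `X` given by an inner product. -/
def X.mk (b : InnerProd V) : X V := Quotient.mk (scaling V) b

/-- The action of `PGL(V)` on `X`, induced by the action of `GL(V)` on inner products. -/
def X.act (g : PGLin V) (p : X V) : X V :=
  Quotient.liftOn₂' g p (fun h b => X.mk (h • b)) (by
    intro h b h' b' hh hb
    obtain ⟨t, ht, htb⟩ := hb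
    obtain ⟨c, hc⟩ := (mem_scalars V).1 (QuotientGroup.leftRel_apply.1 hh)
    have key : ∀ v : V, (h⁻¹).val v = (c : ℝ) • (h'⁻¹).val v := by
      intro v
      rw [← hc, ← Module.End.mul_apply, ← Units.val_mul, mul_assoc, mul_inv_cancel, mul_one]
    refine Quotient.sound ⟨t * ((c : ℝ) ^ 2)⁻¹, by have := c.ne_zero; positivity, fun v w => ?_⟩
    have hc0 : (c : ℝ) ≠ 0 := c.ne_zero
    rw [InnerProd.smul_form, InnerProd.smul_form, htb, key v, key w]
    simp only [map_smul, LinearMap.smul_apply, smul_eq_mul]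
    field_simp)

instance : MulAction (PGLin V) (X V) where
  smul := X.act
  one_smul p := by
    induction p using Quotient.inductionOn with
    | h b => exact congrArg X.mk (one_smul (GLin V) b)
  mul_smul g h p := by
    induction p using Quotient.inductionOn with
    | h b =>
    induction g using QuotientGroup.induction_on with
    | H g =>
    induction h using QuotientGroup.induction_on with
    | H h => exact congrArg X.mk (mul_smul g h b)

theorem X.smul_mk (g : GLin V) (b : InnerProd V) :
    (QuotientGroup.mk g : PGLin V) • X.mk b = X.mk (g • b) := rfl

/-! ### The Riemannian distance -/

section Distance

variable [FiniteDimensional ℝ V]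

/-- The norm, for the invariant Riemannian metric of `X` at `[b]`, of the tangent vector
represented by the symmetric form `s`. Writing `s(v, w) = b(S v, w)`, it is
`½ √(tr (S₀²))`, where `S₀ = S - (tr S / n) id` is the trace-free part of `S`: the trace part is
tangent to the scaling direction that `X` divides out. The factor `½` normalises the metric so that
`diag(e^{x₁}, …, e^{xₙ}) • o` lies at distance `‖x‖` from `o` when `∑ xᵢ = 0`. -/
def tangentNorm (b : InnerProd V) (s : LinearMap.BilinForm ℝ V) : ℝ :=
  let S : Module.End ℝ V := s.symmCompOfNondegenerate b.form b.nondegenerate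
  let S₀ : Module.End ℝ V :=
    S - (LinearMap.trace ℝ V S / finrank ℝ V) • (LinearMap.id : V →ₗ[ℝ] V)
  1 / 2 * Real.sqrt (LinearMap.trace ℝ V (S₀ * S₀))

/-- `P` is a `C¹` path of inner products on `[0, 1]` with velocity `P'`. -/
def IsC1Path (P : ℝ → InnerProd V) (P' : ℝ → LinearMap.BilinForm ℝ V) : Prop :=
  (∀ t ∈ Set.Icc (0 : ℝ) 1, ∀ v w : V,
    HasDerivWithinAt (fun s => (P s).form v w) (P' t v w) (Set.Icc 0 1) t) ∧
  ∀ v w : V, ContinuousOn (fun t => P' t v w) (Set.Icc 0 1)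

/-- The Riemannian distance of `X`: the infimum of the lengths of the `C¹` paths in `X` from `p` to
`q`. Paths in `X` are given by their lifts to the space of inner products; the length does not
depend on the lift. -/
def dX (p q : X V) : ℝ :=
  sInf {L : ℝ | ∃ (P : ℝ → InnerProd V) (P' : ℝ → LinearMap.BilinForm ℝ V), IsC1Path P P' ∧
    X.mk (P 0) = p ∧ X.mk (P 1) = q ∧ L = ∫ t in (0 : ℝ)..1, tangentNorm (P t) (P' t)}

/-- The distance from a point to a subset of `X`. -/
def distToSet (p : X V) (F : Set (X V)) : ℝ := sInf ((fun q => dX p q) '' F)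

/-- The sequence `(x_i)` is `C`-bounded from `F`: it stays in the `C`-neighbourhood of `F`. -/
def IsBoundedFrom (C : ℝ) (F : Set (X V)) (x : ℕ → X V) : Prop :=
  ∀ i : ℕ, distToSet (x i) F ≤ C

end Distance

/-! ### Maximal flats -/

/-- `h` is represented by a diagonal matrix in the basis `e`. -/
def IsDiagonalIn {ι : Type*} (e : Basis ι ℝ V) (h : PGLin V) : Prop :=
  ∃ ĥ : GLin V, (QuotientGroup.mk ĥ : PGLin V) = h ∧ ∀ i, ∃ c : ℝ, ĥ.val (e i) = c • e i

/-- The subgroup `A` is diagonalizable: each of its elements is diagonalizable over `ℝ`. -/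
def IsDiagonalizable (A : Subgroup (PGLin V)) : Prop :=
  ∀ a ∈ A, ∃ e : Basis (Fin (finrank ℝ V)) ℝ V, IsDiagonalIn e a

/-- `A` is diagonalizable, connected and abelian. -/
def IsDiagConnAbelian (A : Subgroup (PGLin V)) : Prop :=
  IsDiagonalizable A ∧ @IsConnected _ (pglTopology V) (A : Set (PGLin V)) ∧
    ∀ a ∈ A, ∀ a' ∈ A, a * a' = a' * a

/-- `e` is an appropriate basis for `(A, p)`: every element of `A` is diagonal in `e`, and `e` is
orthonormal for some inner product in the scalar class `p`. -/
def IsAppropriateBasis (e : Basis (Fin (finrank ℝ V)) ℝ V) (A : Subgroup (PGLin V)) (p : X V) :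
    Prop :=
  (∀ a ∈ A, IsDiagonalIn e a) ∧
    ∃ b : InnerProd V, X.mk b = p ∧ ∀ i j, b.form (e i) (e j) = if i = j then 1 else 0

/-- The maximal flats of `X`: the orbits `A • p`, where `A` is a maximal diagonalizable, connected,
abelian subgroup of `PGL(V)` and `(A, p)` has an appropriate basis. -/
def IsMaximalFlat (F : Set (X V)) : Prop :=
  ∃ (A : Subgroup (PGLin V)) (p : X V), Maximal IsDiagConnAbelian A ∧
    (∃ e, IsAppropriateBasis e A p) ∧ F = {q | ∃ a ∈ A, q = a • p}

end SymmetricSpace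

/-! ## Cartan projection and simple roots -/

section Cartan

variable {V : Type*} [AddCommGroup V] [Module ℝ V]

/-- The inner product `b`, as data from which Mathlib builds a Euclidean structure on `V`. -/
abbrev InnerProd.core (b : InnerProd V) : InnerProductSpace.Core ℝ V where
  inner v w := b.form v w
  conj_inner_symm v w := b.symm w v
  re_inner_nonneg v := by
    by_cases h : v = 0
    · simp [h]
    · exact (b.pos v h).le
  add_left u v w := by simp
  smul_left v w c := by simp
  definite v hv := by
    by_contra h
    exact (b.pos v h).ne' hv

variable [FiniteDimensional ℝ V]

/-- The singular values `σ₀ ≥ σ₁ ≥ …` of a linear map for the inner product `b`. -/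
def singularValue (b : InnerProd V) (T : Module.End ℝ V) (k : ℕ) : ℝ :=
  letI := b.core.toNormedAddCommGroup
  letI : InnerProductSpace ℝ V := InnerProductSpace.ofCore b.core.toCore
  LinearMap.singularValues (E := V) (F := V) T k

/-- The Cartan projection of `GL(V)`. -/
def cartanGL (b : InnerProd V) (g : GLin V) : Fin (finrank ℝ V) → ℝ :=
  fun k => Real.log (singularValue b g.val k)

/-- The Cartan projection of `PGL(V)` given by `b`: that of a representative with `|det| = 1`. -/
def cartan (b : InnerProd V) (g : PGLin V) : Fin (finrank ℝ V) → ℝ :=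
  cartanGL b (unimodularRep g)

theorem singularValue_neg (b : InnerProd V) (T : Module.End ℝ V) (k : ℕ) :
    singularValue b (-T) k = singularValue b T k := by
  let := b.core.toNormedAddCommGroup
  let : InnerProductSpace ℝ V := InnerProductSpace.ofCore b.core.toCore
  have h : LinearMap.adjoint (E := V) (F := V) (-T) ∘ₗ (-T) =
      LinearMap.adjoint (E := V) (F := V) T ∘ₗ T := by
    rw [map_neg]; ext v; simp
  have : LinearMap.singularValues (E := V) (F := V) (-T)
      = LinearMap.singularValues (E := V) (F := V) T := by
    unfold LinearMap.singularValues
    congr 2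
    funext i
    congr 2
  exact congrArg (fun f => f k) this

/-- The Cartan projection of `PGL(V)` may be computed from any representative with `|det| = 1`. -/
theorem cartan_mk (b : InnerProd V) (g : GLin V) (hg : |LinearMap.det g.val| = 1) :
    cartan b (QuotientGroup.mk g) = cartanGL b g := by
  obtain ⟨h1, h2⟩ := (exists_unimodular (QuotientGroup.mk g : PGLin V)).choose_spec
  change _ = _ at h1
  change cartanGL b (unimodularRep _) = _
  have hh2 : |LinearMap.det (unimodularRep (QuotientGroup.mk g : PGLin V)).val| = 1 := h2
  have hh1 : (QuotientGroup.mk (unimodularRep (QuotientGroup.mk g)) : PGLin V)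
    = QuotientGroup.mk g := h1
  generalize unimodularRep (QuotientGroup.mk g : PGLin V) = h at hh1 hh2
  obtain ⟨c, hc⟩ := (mem_scalars V).1 (QuotientGroup.eq.1 hh1)
  have hgh : g.val = (c : ℝ) • h.val := by
    ext v
    have : g.val v = h.val ((h⁻¹ * g).val v) := by
      rw [← Module.End.mul_apply, ← Units.val_mul, mul_inv_cancel_left]
    rw [this, hc]; simp
  by_cases hn : finrank ℝ V = 0
  · funext k; exact absurd k.2 (by omega)
  have hc1 : |(c : ℝ)| = 1 := by
    rw [hgh, LinearMap.det_smul, abs_mul, hh2, mul_one, abs_pow] at hg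
    exact (pow_eq_one_iff_of_nonneg (abs_nonneg _) hn).1 hg
  funext k
  change Real.log (singularValue b h.val k) = Real.log (singularValue b g.val k)
  rcases eq_or_eq_neg_of_abs_eq hc1 with h' | h'
  · rw [hgh, h', one_smul]
  · rw [hgh, h', neg_one_smul, singularValue_neg]

/-- The `k`-th simple root `x ↦ x_k - x_{k+1}` on `ℝⁿ` (zero-based indices). -/
def simpleRoot {n : ℕ} (k : Fin (n - 1)) (x : Fin n → ℝ) : ℝ :=
  x ⟨k, by omega⟩ - x ⟨k + 1, by omega⟩

/-! ## Directed Anosov representations -/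

/-- `ρ` is (Borel) `R`-directed Anosov. The inner product `b` represents the base point. -/
def IsDirectedAnosov {Γ : Type*} [Group Γ] (R : Set Γ) (b : InnerProd V) (ρ : Γ →* PGLin V) : Prop :=
  ∃ κ κ' : ℝ, 0 < κ ∧ 0 < κ' ∧ ∀ η : ℕ → Γ, IsRootedDirectedRay R η →
    ∀ (k : Fin (finrank ℝ V - 1)) (i : ℕ),
      simpleRoot k (cartan b (ρ (η i))) ≥ κ * i - κ'

end Cartan

end

end DirectedAnosov

/-! Near a maximal flat the orbit of a ray is described by diagonal inner products `c i` in one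
fixed basis `e`, so each pair of basis indices gives a real sequence, the log ratio of two diagonal
entries of `c i`. Its increment from `i` to `j` is, up to a bounded error and a permutation of the
indices, twice a difference of two Cartan coordinates of `ρ ((η j)⁻¹ * η i)`.

The comparison rests on two facts. A path of length `D` in `X` changes the ratio of the squared
norms of two vectors by a factor of at most `exp (4 * D)` (`isClose_of_dX_lt`), and such a change
moves differences of sorted relative eigenvalues by a bounded amount, by a Courant–Fischer argument
(`logRatio_sub_le`).

One step of the ray changes each sequence by at most `D`, as `R` is finite. Divergence of the simple
roots, made uniform in the word length (`exists_uniform_le_simpleRoot`), makes the change over `L`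
steps exceed `D` in absolute value. Increments over `L` steps then cannot switch sign along the ray,
so they accumulate and the sequence grows linearly (`linear_growth`). Comparing time `i` with time
`0` returns this growth to the simple roots of `ρ (η i)`. -/

namespace DirectedAnosov

/-! ### Projective comparison of inner products -/

section Closeness

variable {V : Type*} [AddCommGroup V] [Module ℝ V]

theorem InnerProd.nonneg (b : InnerProd V) (v : V) : 0 ≤ b.form v v := by
  by_cases h : v = 0
  · simp [h]
  · exact (b.pos v h).le

/-- The ratio `c(v, v) / b(v, v)` varies by at most the factor `K`. This only depends on the scaling
classes of `b` and `c`. -/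
def IsClose (K : ℝ) (b c : InnerProd V) : Prop :=
  ∀ v w : V, c.form v v * b.form w w ≤ K * (b.form v v * c.form w w)

theorem IsClose.of_mk_eq {K : ℝ} {b c b' c' : InnerProd V} (h : IsClose K b c)
    (hb : X.mk b = X.mk b') (hc : X.mk c = X.mk c') : IsClose K b' c' := by
  obtain ⟨t, ht, hb⟩ := Quotient.exact hb
  obtain ⟨s, hs, hc⟩ := Quotient.exact hc
  intro v w
  rw [hb, hb, hc, hc]
  have := mul_le_mul_of_nonneg_left (h v w) (mul_pos hs ht).le
  linarith

end Closeness

/-! ### Relative eigenvalues and their stability -/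

section RelativeEigenvalues

variable {V : Type*} [AddCommGroup V] [Module ℝ V]

variable {ι : Type*}

/-- The logarithm of the `i`-th diagonal entry of `c` relative to `b` in the basis `e`. -/
noncomputable def logRatio (e : ι → V) (b c : InnerProd V) (i : ι) : ℝ :=
  Real.log (c.form (e i) (e i)) - Real.log (b.form (e i) (e i))

theorem form_eq_exp_logRatio_mul (e : Basis ι ℝ V) (b c : InnerProd V) (i : ι) :
    c.form (e i) (e i) = Real.exp (logRatio e b c i) * b.form (e i) (e i) := by
  rw [logRatio, Real.exp_sub, Real.exp_log (c.pos _ (e.ne_zero i)),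
    Real.exp_log (b.pos _ (e.ne_zero i)), div_mul_cancel₀ _ (b.pos _ (e.ne_zero i)).ne']

variable [Fintype ι]

theorem InnerProd.form_self_eq_sum (b : InnerProd V) (e : Basis ι ℝ V) (h : b.form.IsOrthoᵢ e)
    (v : V) : b.form v v = ∑ i, e.repr v i ^ 2 * b.form (e i) (e i) := by
  classical
  rw [← LinearMap.sum_repr_mul_repr_mul e e (B := b.form), Finsupp.sum_fintype _ _ (by simp)]
  refine Finset.sum_congr rfl fun i _ => ?_
  rw [Finsupp.sum_fintype _ _ (by simp), Finset.sum_eq_single i]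
  · simp only [smul_eq_mul]; ring
  · intro j _ hj
    rw [LinearMap.isOrthoᵢ_def.1 h i j hj.symm]; simp
  · simp

theorem form_le_of_repr_eq_zero (e : Basis ι ℝ V) {b c : InnerProd V} (hb : b.form.IsOrthoᵢ e)
    (hc : c.form.IsOrthoᵢ e) {x : ℝ} {v : V} (h : ∀ i, x < logRatio e b c i → e.repr v i = 0) :
    c.form v v ≤ Real.exp x * b.form v v := by
  rw [c.form_self_eq_sum e hc, b.form_self_eq_sum e hb, Finset.mul_sum]
  refine Finset.sum_le_sum fun i _ => ?_
  by_cases hi : x < logRatio e b c i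
  · simp [h i hi]
  · rw [form_eq_exp_logRatio_mul e b c i, mul_left_comm]
    have := Real.exp_le_exp.2 (not_lt.1 hi)
    have := b.nonneg (e i)
    gcongr

theorem le_form_of_repr_eq_zero (e : Basis ι ℝ V) {b c : InnerProd V} (hb : b.form.IsOrthoᵢ e)
    (hc : c.form.IsOrthoᵢ e) {x : ℝ} {v : V} (h : ∀ i, logRatio e b c i < x → e.repr v i = 0) :
    Real.exp x * b.form v v ≤ c.form v v := by
  rw [c.form_self_eq_sum e hc, b.form_self_eq_sum e hb, Finset.mul_sum]
  refine Finset.sum_le_sum fun i _ => ?_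
  by_cases hi : logRatio e b c i < x
  · simp [h i hi]
  · rw [form_eq_exp_logRatio_mul e b c i, mul_left_comm]
    have := Real.exp_le_exp.2 (not_lt.1 hi)
    have := b.nonneg (e i)
    gcongr

/-- Dimension count: each index other than `k` imposes one linear condition, `n - 1` in all on an
`n`-dimensional space. -/
theorem exists_ne_zero_repr_eq_zero {n : ℕ} (e f : Basis (Fin n) ℝ V) (k : Fin n) :
    ∃ v : V, v ≠ 0 ∧ (∀ i, k < i → e.repr v i = 0) ∧ ∀ i, i < k → f.repr v i = 0 := by
  have : Module.Finite ℝ V := Module.Finite.of_basis e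
  let T : V →ₗ[ℝ] ({i : Fin n // i ≠ k} → ℝ) :=
    LinearMap.pi fun i => if k < i.1 then e.coord i.1 else f.coord i.1
  have hT : LinearMap.ker T ≠ ⊥ := by
    apply LinearMap.ker_ne_bot_of_finrank_lt
    have := k.2
    simp [finrank_eq_card_basis e]
    omega
  obtain ⟨v, hv, hv0⟩ := (Submodule.ne_bot_iff _).1 hT
  have key : ∀ i (hi : i ≠ k), (if k < i then e.coord i else f.coord i) v = 0 := fun i hi =>
    congrFun (LinearMap.mem_ker.1 hv) ⟨i, hi⟩
  refine ⟨v, hv0, fun i hi => ?_, fun i hi => ?_⟩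
  · simpa [hi] using key i hi.ne'
  · simpa [not_lt.2 hi.le] using key i hi.ne

/-- The Courant–Fischer step: the span of the first `k + 1` vectors of `e` meets the span of the
vectors of `f` from index `k` on. A common vector compares the two `k`-th eigenvalues. -/
theorem exists_ne_zero_form_le {n : ℕ} {e f : Basis (Fin n) ℝ V} {b c b' c' : InnerProd V}
    (hb : b.form.IsOrthoᵢ e) (hc : c.form.IsOrthoᵢ e) (hb' : b'.form.IsOrthoᵢ f)
    (hc' : c'.form.IsOrthoᵢ f) (he : Antitone (logRatio e b c)) (hf : Antitone (logRatio f b' c'))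
    (k : Fin n) : ∃ v : V, v ≠ 0 ∧ Real.exp (logRatio e b c k) * b.form v v ≤ c.form v v ∧
      c'.form v v ≤ Real.exp (logRatio f b' c' k) * b'.form v v := by
  obtain ⟨v, hv, h1, h2⟩ := exists_ne_zero_repr_eq_zero e f k
  exact ⟨v, hv, le_form_of_repr_eq_zero e hb hc fun i hi => h1 i (he.reflect_lt hi),
    form_le_of_repr_eq_zero f hb' hc' fun i hi => h2 i (hf.reflect_lt hi)⟩

/-- Closeness ignores scaling, so only differences of eigenvalues can be controlled. One test vector
bounds the `k`-th eigenvalue, another, with the two pairs exchanged, the `l`-th; each of the two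
closeness hypotheses costs `x`. -/
theorem logRatio_sub_le {n : ℕ} {e f : Basis (Fin n) ℝ V} {b c b' c' : InnerProd V}
    (hb : b.form.IsOrthoᵢ e) (hc : c.form.IsOrthoᵢ e) (hb' : b'.form.IsOrthoᵢ f)
    (hc' : c'.form.IsOrthoᵢ f) (he : Antitone (logRatio e b c)) (hf : Antitone (logRatio f b' c'))
    {x : ℝ} (hbb : IsClose (Real.exp x) b b') (hcc : IsClose (Real.exp x) c c') (k l : Fin n) :
    (logRatio e b c k - logRatio e b c l) - (logRatio f b' c' k - logRatio f b' c' l) ≤ 2 * x := by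
  obtain ⟨v, hv, hv1, hv2⟩ := exists_ne_zero_form_le hb hc hb' hc' he hf k
  obtain ⟨w, hw, hw1, hw2⟩ := exists_ne_zero_form_le hb' hc' hb hc hf he l
  have pos : ∀ (d : InnerProd V) {u : V}, u ≠ 0 → 0 < d.form u u := fun d {u} hu => d.pos u hu
  have log_le : ∀ {y p q : ℝ}, 0 < p → Real.exp y * p ≤ q → y + Real.log p ≤ Real.log q := by
    intro y p q hp h
    have := Real.log_le_log (by positivity) h
    rwa [Real.log_mul (Real.exp_pos _).ne' hp.ne', Real.log_exp] at this
  have le_log : ∀ {y p q : ℝ}, 0 < p → 0 < q → q ≤ Real.exp y * p →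
      Real.log q ≤ y + Real.log p := by
    intro y p q hp hq h
    have := Real.log_le_log hq h
    rwa [Real.log_mul (Real.exp_pos _).ne' hp.ne', Real.log_exp] at this
  have h1 := log_le (pos b hv) hv1
  have h2 := le_log (pos b' hv) (pos c' hv) hv2
  have h3 := log_le (pos b' hw) hw1
  have h4 := le_log (pos b hw) (pos c hw) hw2
  have h5 := le_log (mul_pos (pos b hv) (pos b' hw)) (mul_pos (pos b' hv) (pos b hw)) (hbb v w)
  have h6 := le_log (mul_pos (pos c hw) (pos c' hv)) (mul_pos (pos c' hw) (pos c hv)) (hcc w v)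
  rw [Real.log_mul (pos _ hv).ne' (pos _ hw).ne', Real.log_mul (pos _ hv).ne' (pos _ hw).ne'] at h5
  rw [Real.log_mul (pos _ hw).ne' (pos _ hv).ne', Real.log_mul (pos _ hw).ne' (pos _ hv).ne'] at h6
  linarith

/-- The basis attached to a flat comes in no particular order; `π` sorts it so that the monotone
comparison applies. -/
theorem exists_perm_abs_logRatio_sub_le {n : ℕ} {e f : Basis (Fin n) ℝ V} {b c b' c' : InnerProd V}
    (hb : b.form.IsOrthoᵢ e) (hc : c.form.IsOrthoᵢ e) (hb' : b'.form.IsOrthoᵢ f)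
    (hc' : c'.form.IsOrthoᵢ f) (he : Antitone (logRatio e b c))
    {x : ℝ} (hbb : IsClose (Real.exp x) b b') (hcc : IsClose (Real.exp x) c c') :
    ∃ π : Equiv.Perm (Fin n), ∀ k l, |(logRatio e b c k - logRatio e b c l) -
      (logRatio f b' c' (π k) - logRatio f b' c' (π l))| ≤ 2 * x := by
  set π := Tuple.sort (fun i => - logRatio f b' c' i) with hπ
  have hmono : Monotone ((fun i => - logRatio f b' c' i) ∘ π) := Tuple.monotone_sort _
  have hcoe : ⇑(f.reindex π.symm) = f ∘ π := by ext i; simp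
  have hf : logRatio (f.reindex π.symm) b' c' = logRatio f b' c' ∘ π := by
    ext i; simp [logRatio]
  have ortho : ∀ {d : InnerProd V}, d.form.IsOrthoᵢ f → d.form.IsOrthoᵢ (f.reindex π.symm) := by
    intro d hd
    rw [LinearMap.isOrthoᵢ_def] at hd ⊢
    intro i j hij
    rw [hcoe]
    exact hd _ _ (π.injective.ne hij)
  have hanti : Antitone (logRatio (f.reindex π.symm) b' c') := by
    rw [hf]; intro i j hij; exact neg_le_neg_iff.1 (hmono hij)
  have key := logRatio_sub_le hb hc (ortho hb') (ortho hc') he hanti hbb hcc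
  rw [hf] at key
  refine ⟨π, fun k l => abs_le.2 ⟨?_, key k l⟩⟩
  have := key l k
  simp only [Function.comp_apply] at this
  linarith

end RelativeEigenvalues

/-! ### Singular values as relative eigenvalues -/

section SingularValues

variable {V : Type*} [AddCommGroup V] [Module ℝ V] [FiniteDimensional ℝ V]

/-- An orthonormal eigenbasis of `T* T`, whose eigenvalues are the squared singular values. -/
theorem exists_singular_basis (b : InnerProd V) (T : Module.End ℝ V) :
    ∃ e : Basis (Fin (finrank ℝ V)) ℝ V, (∀ i j, b.form (e i) (e j) = if i = j then 1 else 0) ∧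
      (∀ i j, b.form (T (e i)) (T (e j)) = if i = j then singularValue b T i ^ 2 else 0) := by
  let := b.core.toNormedAddCommGroup
  let : InnerProductSpace ℝ V := InnerProductSpace.ofCore b.core.toCore
  have hin : ∀ v w : V, b.form v w = inner ℝ v w := fun v w => rfl
  have hs := LinearMap.isSymmetric_adjoint_comp_self (E := V) (F := V) T
  let e := hs.eigenvectorBasis rfl
  have horth := orthonormal_iff_ite.1 e.orthonormal
  refine ⟨e.toBasis, fun i j => ?_, fun i j => ?_⟩
  · rw [hin]; simpa using horth i j
  · have hσ : singularValue b T i ^ 2 = hs.eigenvalues rfl i :=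
      LinearMap.sq_singularValues_fin (E := V) (F := V) T rfl i
    have hi : (LinearMap.adjoint (E := V) (F := V) T ∘ₗ T) (e i) = hs.eigenvalues rfl i • e i :=
      hs.apply_eigenvectorBasis rfl i
    rw [hin, ← LinearMap.adjoint_inner_left, hσ]
    change inner ℝ ((LinearMap.adjoint (E := V) (F := V) T ∘ₗ T) (e.toBasis i)) (e.toBasis j) = _
    simp only [OrthonormalBasis.coe_toBasis]
    rw [hi, inner_smul_left, horth i j]
    split_ifs <;> simp

theorem singularValue_nonneg (b : InnerProd V) (T : Module.End ℝ V) (i : ℕ) :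
    0 ≤ singularValue b T i := by
  let := b.core.toNormedAddCommGroup
  let : InnerProductSpace ℝ V := InnerProductSpace.ofCore b.core.toCore
  exact LinearMap.singularValues_nonneg (E := V) (F := V) T i

theorem singularValue_antitone (b : InnerProd V) (T : Module.End ℝ V) :
    Antitone (singularValue b T) := by
  let := b.core.toNormedAddCommGroup
  let : InnerProductSpace ℝ V := InnerProductSpace.ofCore b.core.toCore
  exact LinearMap.singularValues_antitone (E := V) (F := V) T

theorem singularValue_pos (b : InnerProd V) (g : GLin V) (i : Fin (finrank ℝ V)) :
    0 < singularValue b g.val i := by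
  obtain ⟨e, -, h⟩ := exists_singular_basis b g.val
  have hpos := (g⁻¹ • b).pos _ (e.ne_zero i)
  rw [InnerProd.smul_form, inv_inv, h, if_pos rfl] at hpos
  exact (singularValue_nonneg b _ i).lt_of_ne' (pow_ne_zero_iff two_ne_zero |>.1 hpos.ne')

theorem cartan_antitone (b : InnerProd V) (g : PGLin V) : Antitone (cartan b g) := fun _ j hij =>
  Real.log_le_log (singularValue_pos b _ j) (singularValue_antitone b _ hij)

/-- A basis that is orthonormal for `b`, diagonal for `g⁻¹ • b`, and in which the relative
eigenvalues of these inner products are the squared singular values of `g`. -/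
theorem exists_cartan_basis (b : InnerProd V) (g : PGLin V) :
    ∃ e : Basis (Fin (finrank ℝ V)) ℝ V, b.form.IsOrthoᵢ e ∧
      ((unimodularRep g)⁻¹ • b).form.IsOrthoᵢ e ∧
      ∀ i, logRatio e b ((unimodularRep g)⁻¹ • b) i = 2 * cartan b g i := by
  obtain ⟨e, h1, h2⟩ := exists_singular_basis b (unimodularRep g).val
  have hform : ∀ v w, ((unimodularRep g)⁻¹ • b).form v w =
      b.form ((unimodularRep g).val v) ((unimodularRep g).val w) := by
    intro v w; rw [InnerProd.smul_form, inv_inv]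
  have hlog : ∀ i, logRatio e b ((unimodularRep g)⁻¹ • b) i = 2 * cartan b g i := by
    intro i
    rw [logRatio, hform, h2, h1, if_pos rfl, if_pos rfl, Real.log_one, sub_zero, Real.log_pow]
    rfl
  refine ⟨e, ?_, ?_, hlog⟩
  · rw [LinearMap.isOrthoᵢ_def]; intro i j hij; rw [h1, if_neg hij]
  · rw [LinearMap.isOrthoᵢ_def]; intro i j hij; rw [hform, h2, if_neg hij]

end SingularValues

/-! ### Paths of inner products -/

section Paths

variable {V : Type*} [AddCommGroup V] [Module ℝ V]

theorem IsC1Path.symm {P : ℝ → InnerProd V} {P' : ℝ → LinearMap.BilinForm ℝ V}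
    (h : IsC1Path P P') {t : ℝ} (ht : t ∈ Set.Icc (0 : ℝ) 1) (v w : V) : P' t v w = P' t w v := by
  refine (uniqueDiffOn_Icc zero_lt_one t ht).eq_deriv _ (h.1 t ht v w) ?_
  simpa only [(P _).symm v w] using h.1 t ht w v

theorem IsC1Path.continuousOn {P : ℝ → InnerProd V} {P' : ℝ → LinearMap.BilinForm ℝ V}
    (h : IsC1Path P P') (v w : V) : ContinuousOn (fun t => (P t).form v w) (Set.Icc 0 1) :=
  fun t ht => (h.1 t ht v w).continuousWithinAt

/-- The inner product `(1 - t) b + t c`. -/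
def InnerProd.interp (b c : InnerProd V) (t : Set.Icc (0 : ℝ) 1) : InnerProd V where
  form := b.form + (t : ℝ) • (c.form - b.form)
  symm v w := by simp [b.symm v w, c.symm v w]
  pos v hv := by
    have hb := b.pos v hv
    have hc := c.pos v hv
    have h0 := t.2.1
    have h1 := t.2.2
    simp only [LinearMap.add_apply, LinearMap.smul_apply, LinearMap.sub_apply, smul_eq_mul]
    rcases h0.eq_or_lt with h | h
    · rw [← h]; linarith
    · nlinarith [mul_pos h hc, mul_nonneg (sub_nonneg.2 h1) hb.le]

/-- The affine segment. It ensures that the infimum defining `dX` is not over the empty set. -/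
theorem exists_isC1Path (b c : InnerProd V) :
    ∃ (P : ℝ → InnerProd V) (P' : ℝ → LinearMap.BilinForm ℝ V),
      IsC1Path P P' ∧ P 0 = b ∧ P 1 = c := by
  refine ⟨fun t => b.interp c (Set.projIcc 0 1 zero_le_one t), fun _ => c.form - b.form,
    ⟨fun t ht v w => ?_, fun v w => continuousOn_const⟩, ?_, ?_⟩
  · have hd : HasDerivWithinAt (fun s : ℝ => b.form v w + s * (c.form v w - b.form v w))
        (c.form v w - b.form v w) (Set.Icc 0 1) t := by
      simpa using (((hasDerivAt_id t).mul_const (c.form v w - b.form v w)).const_add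
        (b.form v w)).hasDerivWithinAt (s := Set.Icc 0 1)
    refine hd.congr_of_mem (fun s hs => ?_) ht
    change (b.interp c (Set.projIcc 0 1 zero_le_one s)).form v w = _
    rw [Set.projIcc_of_mem zero_le_one hs]
    rfl
  · ext v w
    simp [InnerProd.interp]
  · ext v w
    simp [InnerProd.interp]

end Paths

/-! ### Simultaneous diagonalization along a flat -/

section Flats

variable {V : Type*} [AddCommGroup V] [Module ℝ V]

/-- All points of a maximal flat are represented by inner products which are diagonal in a common
basis. -/
theorem IsMaximalFlat.exists_basis {F : Set (X V)} (hF : IsMaximalFlat F) :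
    ∃ e : Basis (Fin (finrank ℝ V)) ℝ V, ∀ q ∈ F, ∃ c : InnerProd V, X.mk c = q ∧
      c.form.IsOrthoᵢ e := by
  obtain ⟨A, p, -, ⟨e, hA, b, rfl, hb⟩, rfl⟩ := hF
  refine ⟨e, ?_⟩
  rintro _ ⟨a, ha, rfl⟩
  obtain ⟨g, rfl, hg⟩ := hA a ha
  refine ⟨g • b, rfl, LinearMap.isOrthoᵢ_def.2 fun i j hij => ?_⟩
  have hinv : ∀ i, ∃ x : ℝ, (g⁻¹).val (e i) = x • e i := by
    intro i
    obtain ⟨x, hx⟩ := hg i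
    have hgg : ∀ v, (g⁻¹).val (g.val v) = v := fun v => by
      rw [← Module.End.mul_apply, ← Units.val_mul, inv_mul_cancel]; rfl
    have h1 : e i = x • (g⁻¹).val (e i) := by rw [← map_smul, ← hx, hgg]
    have hx0 : x ≠ 0 := fun h => e.ne_zero i (by rw [h1, h, zero_smul])
    exact ⟨x⁻¹, by conv_rhs => rw [h1, smul_smul, inv_mul_cancel₀ hx0, one_smul]⟩
  obtain ⟨x, hx⟩ := hinv i
  obtain ⟨y, hy⟩ := hinv j
  rw [InnerProd.smul_form, hx, hy]
  simp [hb, hij]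

theorem IsMaximalFlat.nonempty {F : Set (X V)} (hF : IsMaximalFlat F) : F.Nonempty := by
  obtain ⟨A, p, -, -, rfl⟩ := hF
  exact ⟨_, 1, A.one_mem, rfl⟩

end Flats

/-! ### From Riemannian distance to closeness -/

section RiemannianDistance

variable {V : Type*} [AddCommGroup V] [Module ℝ V] [FiniteDimensional ℝ V]

theorem sq_sum_mul_mul_le {ι : Type*} [Fintype ι] (m : ι → ι → ℝ) (x : ι → ℝ) :
    (∑ i, ∑ j, m i j * (x i * x j)) ^ 2 ≤ (∑ i, ∑ j, m i j ^ 2) * (∑ i, x i ^ 2) ^ 2 := by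
  have h := Finset.sum_mul_sq_le_sq_mul_sq Finset.univ (fun p : ι × ι => m p.1 p.2)
    (fun p => x p.1 * x p.2)
  have hx : ∑ p : ι × ι, (x p.1 * x p.2) ^ 2 = (∑ i, x i ^ 2) ^ 2 := by
    rw [Fintype.sum_prod_type, sq, Finset.sum_mul_sum]
    simp [mul_pow]
  rwa [hx, Fintype.sum_prod_type, Fintype.sum_prod_type] at h

omit [FiniteDimensional ℝ V] in
theorem repr_eq_form_of_orthonormal {ι : Type*} [Fintype ι] [DecidableEq ι] (b : InnerProd V)
    (e : Basis ι ℝ V) (he : ∀ i j, b.form (e i) (e j) = if i = j then 1 else 0) (v : V) (i : ι) :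
    e.repr v i = b.form v (e i) := by
  conv_rhs => rw [← e.sum_repr v]
  simp only [map_sum, map_smul, LinearMap.sum_apply, LinearMap.smul_apply, he]
  simp

/-- The quadratic form of a `b`-symmetric endomorphism is bounded by its Frobenius norm. -/
theorem abs_form_le_sqrt_trace (b : InnerProd V) (S : Module.End ℝ V)
    (hS : ∀ v w, b.form (S v) w = b.form (S w) v) (v : V) :
    |b.form (S v) v| ≤ Real.sqrt (LinearMap.trace ℝ V (S * S)) * b.form v v := by
  obtain ⟨e, he, -⟩ := exists_singular_basis b 1
  set m : Fin (finrank ℝ V) → Fin (finrank ℝ V) → ℝ := fun i j => b.form (S (e i)) (e j) with hm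
  have hM : ∀ i j, LinearMap.toMatrix e e S i j = m j i := fun i j => by
    rw [LinearMap.toMatrix_apply, repr_eq_form_of_orthonormal b e he]
  have htr : LinearMap.trace ℝ V (S * S) = ∑ i, ∑ j, m i j ^ 2 := by
    rw [LinearMap.trace_eq_matrix_trace ℝ e, LinearMap.toMatrix_mul, Matrix.trace]
    refine Finset.sum_congr rfl fun i _ => ?_
    rw [Matrix.diag_apply, Matrix.mul_apply]
    refine Finset.sum_congr rfl fun j _ => ?_
    rw [hM, hM, sq, show m j i = m i j from hS _ _]
  have hvv : b.form v v = ∑ i, e.repr v i ^ 2 := by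
    rw [b.form_self_eq_sum e (LinearMap.isOrthoᵢ_def.2 fun i j hij => by rw [he, if_neg hij])]
    simp [he]
  have hSv : b.form (S v) v = ∑ i, ∑ j, m i j * (e.repr v i * e.repr v j) := by
    conv_lhs => rw [← e.sum_repr v]
    simp only [map_sum, map_smul, LinearMap.sum_apply, LinearMap.smul_apply, smul_eq_mul,
      Finset.mul_sum, hm]
    rw [Finset.sum_comm]
    exact Finset.sum_congr rfl fun i _ => Finset.sum_congr rfl fun j _ => by ring
  rw [htr, hvv, hSv]
  refine abs_le_of_sq_le_sq ?_ (by positivity)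
  rw [mul_pow, Real.sq_sqrt (by positivity)]
  exact sq_sum_mul_mul_le _ _

/-- The trace part contributes the same constant `τ` to both Rayleigh quotients and cancels. Each
quotient is within `2 * tangentNorm b s` of `τ`, the `2` undoing the factor `½` of the metric. -/
theorem div_sub_div_le_tangentNorm (b : InnerProd V) (s : LinearMap.BilinForm ℝ V)
    (hs : ∀ v w, s v w = s w v) {v w : V} (hv : v ≠ 0) (hw : w ≠ 0) :
    s v v / b.form v v - s w w / b.form w w ≤ 4 * tangentNorm b s := by
  set S : Module.End ℝ V := s.symmCompOfNondegenerate b.form b.nondegenerate with hS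
  set τ : ℝ := LinearMap.trace ℝ V S / finrank ℝ V with hτ
  set S₀ : Module.End ℝ V := S - τ • (LinearMap.id : V →ₗ[ℝ] V) with hS₀
  have hform : ∀ u u', b.form (S₀ u) u' = s u u' - τ * b.form u u' := by
    intro u u'
    have := LinearMap.BilinForm.symmCompOfNondegenerate_left_apply s b.nondegenerate u' u
    rw [hS₀, LinearMap.sub_apply, map_sub, LinearMap.sub_apply, this]
    simp
  have key : ∀ u, u ≠ 0 → |s u u / b.form u u - τ| ≤ 2 * tangentNorm b s := by
    intro u hu
    have h := abs_form_le_sqrt_trace b S₀ (fun v w => by rw [hform, hform, hs, b.symm]) u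
    have hpos := b.pos u hu
    have : 2 * tangentNorm b s = Real.sqrt (LinearMap.trace ℝ V (S₀ * S₀)) := by
      change 2 * (1 / 2 * Real.sqrt (LinearMap.trace ℝ V (S₀ * S₀))) = _
      ring
    rw [this, div_sub' hpos.ne', abs_div, abs_of_pos hpos, div_le_iff₀ hpos]
    rwa [hform, mul_comm τ] at h
  have h1 := abs_le.1 (key v hv)
  have h2 := abs_le.1 (key w hw)
  linarith

theorem toMatrix_symmCompOfNondegenerate {ι : Type*} [Fintype ι] [DecidableEq ι] (e : Basis ι ℝ V)
    (b : InnerProd V) (s : LinearMap.BilinForm ℝ V) :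
    LinearMap.toMatrix e e (s.symmCompOfNondegenerate b.form b.nondegenerate) =
      (LinearMap.BilinForm.toMatrix e b.form)⁻¹ * (LinearMap.BilinForm.toMatrix e s).transpose := by
  have hdet : IsUnit (LinearMap.BilinForm.toMatrix e b.form).det :=
    ((LinearMap.BilinForm.nondegenerate_iff_det_ne_zero e).1 b.nondegenerate).isUnit
  rw [← Matrix.nonsing_inv_mul_cancel_left _
    (LinearMap.toMatrix e e (s.symmCompOfNondegenerate b.form b.nondegenerate)) hdet]
  congr 1
  ext i j
  have h := LinearMap.BilinForm.symmCompOfNondegenerate_left_apply s b.nondegenerate (e i) (e j)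
  rw [← e.sum_repr (s.symmCompOfNondegenerate b.form b.nondegenerate (e j))] at h
  rw [Matrix.mul_apply, Matrix.transpose_apply, LinearMap.BilinForm.toMatrix_apply, ← h]
  simp only [map_sum, map_smul, LinearMap.sum_apply, LinearMap.smul_apply, smul_eq_mul]
  refine Finset.sum_congr rfl fun k _ => ?_
  rw [LinearMap.BilinForm.toMatrix_apply, LinearMap.toMatrix_apply, b.symm, mul_comm]

/-- Needed for integrability of the speed: in coordinates the norm is built from matrix entries, a
nonvanishing determinant and a square root. -/
theorem continuous_tangentNorm {T : Type*} [TopologicalSpace T] {P : T → InnerProd V}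
    {P' : T → LinearMap.BilinForm ℝ V} (hP : ∀ v w, Continuous fun t => (P t).form v w)
    (hP' : ∀ v w, Continuous fun t => P' t v w) : Continuous fun t => tangentNorm (P t) (P' t) := by
  let e := finBasis ℝ V
  let B : T → Matrix (Fin (finrank ℝ V)) (Fin (finrank ℝ V)) ℝ := fun t =>
    LinearMap.BilinForm.toMatrix e (P t).form
  let B' : T → Matrix (Fin (finrank ℝ V)) (Fin (finrank ℝ V)) ℝ := fun t =>
    LinearMap.BilinForm.toMatrix e (P' t)
  have hB : Continuous B := continuous_matrix fun i j => by
    simpa only [B, LinearMap.BilinForm.toMatrix_apply] using hP (e i) (e j)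
  have hB' : Continuous B' := continuous_matrix fun i j => by
    simpa only [B', LinearMap.BilinForm.toMatrix_apply] using hP' (e i) (e j)
  have hinv : Continuous fun t => (B t)⁻¹ := by
    simp only [Matrix.inv_def, Ring.inverse_eq_inv']
    refine (hB.matrix_det.inv₀ fun t => ?_).smul hB.matrix_adjugate
    exact (LinearMap.BilinForm.nondegenerate_iff_det_ne_zero e).1 (P t).nondegenerate
  have hM : Continuous fun t => (B t)⁻¹ * (B' t).transpose := hinv.matrix_mul hB'.matrix_transpose
  have hM₀ := hM.sub ((hM.matrix_trace.div_const (finrank ℝ V : ℝ)).smul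
    (continuous_const (y := (1 : Matrix (Fin (finrank ℝ V)) (Fin (finrank ℝ V)) ℝ))))
  convert (Real.continuous_sqrt.comp (hM₀.matrix_mul hM₀).matrix_trace).const_mul (1 / 2) using 2
    with t
  simp only [tangentNorm, Function.comp_apply]
  rw [LinearMap.trace_eq_matrix_trace ℝ e, LinearMap.toMatrix_mul, map_sub, map_smul,
    LinearMap.toMatrix_id, LinearMap.trace_eq_matrix_trace ℝ e, toMatrix_symmCompOfNondegenerate]
  rfl

theorem IsC1Path.continuousOn_tangentNorm {P : ℝ → InnerProd V}
    {P' : ℝ → LinearMap.BilinForm ℝ V} (h : IsC1Path P P') :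
    ContinuousOn (fun t => tangentNorm (P t) (P' t)) (Set.Icc 0 1) := by
  rw [continuousOn_iff_continuous_domRestrict]
  exact continuous_tangentNorm
    (fun v w => continuousOn_iff_continuous_domRestrict.1 (h.continuousOn v w))
    (fun v w => continuousOn_iff_continuous_domRestrict.1 (h.2 v w))

/-- The derivative of `log P(v, v) - log P(w, w)` is a difference of Rayleigh quotients of the
velocity; its pointwise bound is integrated. -/
theorem IsC1Path.log_sub_log_le {P : ℝ → InnerProd V} {P' : ℝ → LinearMap.BilinForm ℝ V}
    (h : IsC1Path P P') {v w : V} (hv : v ≠ 0) (hw : w ≠ 0) :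
    (Real.log ((P 1).form v v) - Real.log ((P 1).form w w)) -
      (Real.log ((P 0).form v v) - Real.log ((P 0).form w w)) ≤
      4 * ∫ t in (0 : ℝ)..1, tangentNorm (P t) (P' t) := by
  rw [← intervalIntegral.integral_const_mul]
  have pos : ∀ {u : V} (t : ℝ), u ≠ 0 → (P t).form u u ≠ 0 := fun t hu => ((P t).pos _ hu).ne'
  refine intervalIntegral.sub_le_integral_of_hasDeriv_right_of_le
    (g := fun t => Real.log ((P t).form v v) - Real.log ((P t).form w w))
    (g' := fun t => P' t v v / (P t).form v v - P' t w w / (P t).form w w) zero_le_one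
    (((h.continuousOn v v).log fun t _ => pos t hv).sub
      ((h.continuousOn w w).log fun t _ => pos t hw)) ?_
    (h.continuousOn_tangentNorm.const_smul (4 : ℝ)).integrableOn_Icc ?_
  · intro t ht
    have hd : ∀ {u : V}, u ≠ 0 → HasDerivAt (fun t => Real.log ((P t).form u u))
        (P' t u u / (P t).form u u) t := fun {u} hu =>
      ((h.1 t (Set.Ioo_subset_Icc_self ht) u u).hasDerivAt (Icc_mem_nhds ht.1 ht.2)).log (pos t hu)
    exact ((hd hv).sub (hd hw)).hasDerivWithinAt
  · exact fun t ht => div_sub_div_le_tangentNorm (P t) (P' t)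
      (h.symm (Set.Ioo_subset_Icc_self ht)) hv hw

theorem IsC1Path.isClose {P : ℝ → InnerProd V} {P' : ℝ → LinearMap.BilinForm ℝ V}
    (h : IsC1Path P P') {D : ℝ} (hD : ∫ t in (0 : ℝ)..1, tangentNorm (P t) (P' t) ≤ D) :
    IsClose (Real.exp (4 * D)) (P 0) (P 1) := by
  intro v w
  by_cases hv : v = 0
  · simp [hv]
  by_cases hw : w = 0
  · simp [hw]
  have key := h.log_sub_log_le hv hw
  have h0v := (P 0).pos v hv
  have h0w := (P 0).pos w hw
  have h1v := (P 1).pos v hv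
  have h1w := (P 1).pos w hw
  rw [← Real.log_le_log_iff (by positivity) (by positivity), Real.log_mul h1v.ne' h0w.ne',
    Real.log_mul (Real.exp_pos _).ne' (by positivity), Real.log_exp, Real.log_mul h0v.ne' h1w.ne']
  linarith

theorem isClose_of_dX_lt {b c : InnerProd V} {D : ℝ} (h : dX (X.mk b) (X.mk c) < D) :
    IsClose (Real.exp (4 * D)) b c := by
  -- The strict bound yields an actual path shorter than `D`; its endpoints are only multiples of
  -- `b` and `c`, which closeness does not see.
  obtain ⟨L, ⟨P, P', hP, h0, h1, rfl⟩, hL⟩ := exists_lt_of_csInf_lt (by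
    obtain ⟨P, P', hP, h0, h1⟩ := exists_isC1Path b c
    exact ⟨_, P, P', hP, by rw [h0], by rw [h1], rfl⟩) h
  exact (hP.isClose hL.le).of_mk_eq h0 h1

theorem exists_dX_lt_of_distToSet_le {F : Set (X V)} (hF : F.Nonempty) {p : X V} {C D : ℝ}
    (h : distToSet p F ≤ C) (hCD : C < D) : ∃ q ∈ F, dX p q < D := by
  obtain ⟨_, ⟨q, hq, rfl⟩, h⟩ := exists_lt_of_csInf_lt (hF.image _) (h.trans_lt hCD)
  exact ⟨q, hq, h⟩

end RiemannianDistance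

/-! ### Real sequences with large increments -/

section LinearGrowth

variable {f : ℕ → ℝ} {D M : ℝ} {L : ℕ}

theorem abs_sub_le_mul_of_abs_succ_sub_le (hD : ∀ i, |f (i + 1) - f i| ≤ D) (i r : ℕ) :
    |f (i + r) - f i| ≤ r * D := by
  induction r with
  | zero => simp
  | succ r ih =>
    have := abs_sub_le (f (i + (r + 1))) (f (i + r)) (f i)
    have := hD (i + r)
    push_cast
    rw [← add_assoc] at *
    linarith

theorem linear_growth_of_le (hL : 0 < L) (hD : ∀ i, |f (i + 1) - f i| ≤ D)
    (hM : ∀ i, M ≤ |f (i + L) - f i|) (hDM : D < M) (h0 : 0 ≤ f L - f 0) (i : ℕ) :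
    M / L * i - (M + L * D) ≤ f i - f 0 := by
  have hD0 : 0 ≤ D := (abs_nonneg _).trans (hD 0)
  have hstep : ∀ i, 0 ≤ f (i + L) - f i := by
    intro i
    induction i with
    | zero => simpa using h0
    | succ i ih =>
      -- A change of sign would make consecutive `L`-step increments differ by at least `2 * M`, but
      -- they differ by at most `2 * D`.
      by_contra hneg
      have h1 := hM i
      have h2 := hM (i + 1)
      rw [abs_of_nonneg ih] at h1
      rw [abs_of_neg (not_le.1 hneg)] at h2
      have h3 := abs_le.1 (hD i)
      have h4 := abs_le.1 (hD (i + L))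
      rw [add_right_comm] at h4
      linarith
  have hmul : ∀ m : ℕ, m * M ≤ f (L * m) - f 0 := by
    intro m
    induction m with
    | zero => simp
    | succ m ih =>
      have h1 := hM (L * m)
      rw [abs_of_nonneg (hstep _)] at h1
      rw [mul_add_one]
      push_cast
      linarith
  have h1 := hmul (i / L)
  have h2 := (abs_le.1 (abs_sub_le_mul_of_abs_succ_sub_le hD (L * (i / L)) (i % L))).1
  rw [Nat.div_add_mod] at h2
  have hr : ((i % L : ℕ) : ℝ) ≤ L := by exact_mod_cast (Nat.mod_lt i hL).le
  have hi : (i : ℝ) = L * (i / L : ℕ) + (i % L : ℕ) := by exact_mod_cast (Nat.div_add_mod i L).symm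
  have hL' : (0 : ℝ) < L := by exact_mod_cast hL
  have h3 : M / L * i ≤ (i / L : ℕ) * M + M := by
    rw [div_mul_eq_mul_div, div_le_iff₀ hL', hi]
    have := mul_le_mul_of_nonneg_left hr (hD0.trans hDM.le)
    linarith
  have h4 := mul_le_mul_of_nonneg_right hr hD0
  linarith

/-- A sequence with increments bounded by `D` and increments over `L` steps of absolute value at
least `M > D` grows linearly: the latter increments cannot change sign. -/
theorem linear_growth (hL : 0 < L) (hD : ∀ i, |f (i + 1) - f i| ≤ D)
    (hM : ∀ i, M ≤ |f (i + L) - f i|) (hDM : D < M) (i : ℕ) :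
    M / L * i - (M + L * D) ≤ |f i - f 0| := by
  rcases le_total 0 (f L - f 0) with h | h
  · exact (linear_growth_of_le hL hD hM hDM h i).trans (le_abs_self _)
  · have neg : ∀ i j, (-f) i - (-f) j = -(f i - f j) := fun i j => by simp; ring
    refine (linear_growth_of_le (f := -f) hL (fun i => ?_) (fun i => ?_) hDM ?_ i).trans ?_
    · rw [neg, abs_neg]; exact hD i
    · rw [neg, abs_neg]; exact hM i
    · rw [neg]; exact neg_nonneg.2 h
    · rw [neg]; exact neg_le_abs _

end LinearGrowth

/-! ### Words along directed rays -/

section Words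

variable {Γ : Type*} [Group Γ] {R : Set Γ} {η : ℕ → Γ}

theorem wordDist_one_left (x y : Γ) : wordDist R 1 (x⁻¹ * y) = wordDist R x y := by
  simp [wordDist]

theorem IsDirected.inv_mul_mem {S : Set Γ} (h : IsDirected S η) (i j : ℕ) :
    (η i)⁻¹ * η (i + j) ∈ Submonoid.closure S := by
  induction j with
  | zero => simp
  | succ j ih =>
    have := mul_mem ih (Submonoid.subset_closure (h (i + j)))
    rwa [mul_assoc, mul_inv_cancel_left, add_assoc] at this

/-- Divergence of roots is known only for products of elements of `R`; on an `R⁻¹`-directed ray it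
is the reversed increment that has this form. -/
theorem IsRootedDirectedRay.mem_closure (h : IsRootedDirectedRay R η) (i j : ℕ) :
    (η i)⁻¹ * η (i + j) ∈ Submonoid.closure R ∨ (η (i + j))⁻¹ * η i ∈ Submonoid.closure R := by
  refine h.2.2.imp (fun h => h.inv_mul_mem i j) fun h => ?_
  have := h.inv_mul_mem i j
  rw [Submonoid.closure_inv, Submonoid.mem_inv] at this
  simpa using this

theorem isEscaping_of_le_wordDist {γ : ℕ → Γ}
    (h : ∀ L, L ≤ wordDist R 1 (γ L) ∨ L ≤ wordDist R 1 (γ L)⁻¹) : IsEscaping γ := by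
  rw [IsEscaping, ← Nat.cofinite_eq_atTop]
  refine Tendsto.cofinite_of_finite_preimage_singleton fun g => ?_
  refine (Set.finite_Iic (max (wordDist R 1 g) (wordDist R 1 g⁻¹))).subset ?_
  rintro L rfl
  exact le_max_iff.2 (h L)

end Words

/-! ### Cartan projections of pairs of orbit points -/

section Cartan

variable {V : Type*} [AddCommGroup V] [Module ℝ V] [FiniteDimensional ℝ V]

theorem simpleRoot_cartan_nonneg (b : InnerProd V) (g : PGLin V) (k : Fin (finrank ℝ V - 1)) :
    0 ≤ simpleRoot k (cartan b g) :=
  sub_nonneg.2 (cartan_antitone b g (Fin.mk_le_mk.2 (Nat.le_succ k)))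

theorem le_cartan_sub_of_le_simpleRoot {b : InnerProd V} {g : PGLin V} {N : ℝ}
    (h : ∀ k, N ≤ simpleRoot k (cartan b g)) {k l : Fin (finrank ℝ V)} (hkl : k < l) :
    N ≤ cartan b g k - cartan b g l := by
  have hk : (k : ℕ) < finrank ℝ V - 1 := by omega
  have h1 := h ⟨k, hk⟩
  have h2 : cartan b g l ≤ cartan b g ⟨k + 1, by omega⟩ :=
    cartan_antitone b g (Fin.mk_le_of_le_val hkl)
  rw [simpleRoot] at h1
  linarith

/-- Translate by `g` the singular basis of `k = h⁻¹ * g`: it is diagonal for `g • b` and for `g •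
k⁻¹ • b`, which represents `h • X.mk b`. -/
theorem exists_cartan_basis_pair (b : InnerProd V) (g h : PGLin V) :
    ∃ (e : Basis (Fin (finrank ℝ V)) ℝ V) (c d : InnerProd V), X.mk c = g • X.mk b ∧
      X.mk d = h • X.mk b ∧ c.form.IsOrthoᵢ e ∧ d.form.IsOrthoᵢ e ∧
      ∀ i, logRatio e c d i = 2 * cartan b (h⁻¹ * g) i := by
  obtain ⟨e, h1, h2, h3⟩ := exists_cartan_basis b (h⁻¹ * g)
  set k := unimodularRep (h⁻¹ * g) with hk
  have hkm : (QuotientGroup.mk k : PGLin V) = h⁻¹ * g := (exists_unimodular (h⁻¹ * g)).choose_spec.1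
  obtain ⟨g, rfl⟩ := QuotientGroup.mk_surjective g
  have hg : ∀ (c : InnerProd V) v w, (g • c).form (g.val v) (g.val w) = c.form v w := by
    intro c v w
    have hgg : ∀ v, (g⁻¹).val (g.val v) = v := fun v => by
      rw [← Module.End.mul_apply, ← Units.val_mul, inv_mul_cancel]; rfl
    rw [InnerProd.smul_form, hgg, hgg]
  let e' := e.map (LinearMap.GeneralLinearGroup.generalLinearEquiv ℝ V g)
  have he' : ∀ i, e' i = g.val (e i) := fun i => by simp [e']
  refine ⟨e', g • b, g • (k⁻¹ • b), rfl, ?_, ?_, ?_, ?_⟩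
  · rw [← X.smul_mk, ← X.smul_mk, QuotientGroup.mk_inv, hkm, smul_smul]
    congr 1
    group
  · rw [LinearMap.isOrthoᵢ_def] at h1 ⊢
    intro i j hij
    rw [he', he', hg]
    exact h1 i j hij
  · rw [LinearMap.isOrthoᵢ_def] at h2 ⊢
    intro i j hij
    rw [he', he', hg]
    exact h2 i j hij
  · intro i
    rw [← h3, logRatio, logRatio, he', hg, hg]

/-- `c` is close to the point `p` of `X`. -/
def IsCloseTo (K : ℝ) (p : X V) (c : InnerProd V) : Prop :=
  ∀ b : InnerProd V, X.mk b = p → IsClose K b c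

theorem exists_perm_abs_cartan_sub_le {b c d : InnerProd V} {g h : PGLin V} {x : ℝ}
    {e : Basis (Fin (finrank ℝ V)) ℝ V} (hc : c.form.IsOrthoᵢ e) (hd : d.form.IsOrthoᵢ e)
    (hgc : IsCloseTo (Real.exp x) (g • X.mk b) c) (hhd : IsCloseTo (Real.exp x) (h • X.mk b) d) :
    ∃ π : Equiv.Perm (Fin (finrank ℝ V)), ∀ k l,
      |2 * (cartan b (h⁻¹ * g) k - cartan b (h⁻¹ * g) l) -
        (logRatio e c d (π k) - logRatio e c d (π l))| ≤ 2 * x := by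
  obtain ⟨f, c', d', hc', hd', hcf, hdf, hlog⟩ := exists_cartan_basis_pair b g h
  have hanti : Antitone (logRatio f c' d') := fun i j hij => by
    rw [hlog, hlog]
    exact mul_le_mul_of_nonneg_left (cartan_antitone b _ hij) zero_le_two
  obtain ⟨π, hπ⟩ := exists_perm_abs_logRatio_sub_le hcf hdf hc hd hanti (hgc c' hc') (hhd d' hd')
  refine ⟨π, fun k l => ?_⟩
  have := hπ k l
  rwa [hlog, hlog, ← mul_sub] at this

theorem exists_diagonal_isCloseTo {C : ℝ} {F : Set (X V)} (hF : IsMaximalFlat F) {x : ℕ → X V}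
    (hx : IsBoundedFrom C F x) : ∃ (e : Basis (Fin (finrank ℝ V)) ℝ V) (c : ℕ → InnerProd V),
      ∀ i, (c i).form.IsOrthoᵢ e ∧ IsCloseTo (Real.exp (4 * (C + 1))) (x i) (c i) := by
  obtain ⟨e, he⟩ := hF.exists_basis
  have : ∀ i, ∃ c : InnerProd V, c.form.IsOrthoᵢ e ∧
      IsCloseTo (Real.exp (4 * (C + 1))) (x i) c := by
    intro i
    obtain ⟨q, hq, hqd⟩ := exists_dX_lt_of_distToSet_le hF.nonempty (hx i) (lt_add_one C)
    obtain ⟨c, rfl, hc⟩ := he q hq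
    exact ⟨c, hc, fun b hb => isClose_of_dX_lt (by rwa [hb])⟩
  choose c hc using this
  exact ⟨e, c, hc⟩

end Cartan

/-! ### Uniform bounds and the theorem -/

section Main

variable {V : Type*} [AddCommGroup V] [Module ℝ V] [FiniteDimensional ℝ V]
  {Γ : Type*} [Group Γ] {R : Set Γ} {b : InnerProd V} {ρ : Γ →* PGLin V}

/-- Counterexamples chosen for every `L` would form an escaping sequence with, at each index, some
root below `N`. Allowing the length of `γ` or of `γ⁻¹` serves both directions of rays. -/
theorem exists_uniform_le_simpleRoot
    (hroots : ∀ η : ℕ → Γ, IsEscaping η → (∀ i, η i ∈ Submonoid.closure R) →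
      ∀ k : Fin (finrank ℝ V - 1),
        Tendsto (fun i => simpleRoot k (cartan b (ρ (η i)))) atTop atTop) (N : ℝ) :
    ∃ L : ℕ, ∀ γ ∈ Submonoid.closure R, (L ≤ wordDist R 1 γ ∨ L ≤ wordDist R 1 γ⁻¹) →
      ∀ k, N ≤ simpleRoot k (cartan b (ρ γ)) := by
  by_contra! hcon
  choose γ hγ hL k hk using hcon
  have := eventually_all.2 fun k =>
    (hroots γ (isEscaping_of_le_wordDist hL) hγ k).eventually_ge_atTop N
  obtain ⟨i, hi⟩ := this.exists
  exact (hi (k i)).not_gt (hk i)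

theorem exists_cartan_sub_le (hR : R.Finite) (b : InnerProd V) (ρ : Γ →* PGLin V) :
    ∃ D : ℝ, ∀ γ, γ ∈ R ∨ γ⁻¹ ∈ R → ∀ k l,
      |cartan b (ρ γ) k - cartan b (ρ γ) l| ≤ D := by
  have hfin : (⋃ k, ⋃ l, (fun γ => |cartan b (ρ γ) k - cartan b (ρ γ) l|) '' (R ∪ R⁻¹)).Finite :=
    Set.finite_iUnion fun k => Set.finite_iUnion fun l => (hR.union hR.inv).image _
  obtain ⟨D, hD⟩ := hfin.bddAbove
  exact ⟨D, fun γ hγ k l => hD (Set.mem_iUnion.2 ⟨k, Set.mem_iUnion.2 ⟨l, γ, hγ, rfl⟩⟩)⟩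

end Main

end DirectedAnosov

open DirectedAnosov in
theorem mainTheorem5 {V : Type*} [AddCommGroup V] [Module ℝ V] [FiniteDimensional ℝ V]
    {Γ : Type*} [Group Γ] (R : Set Γ) (hRfin : R.Finite) (hRgen : Subgroup.closure R = ⊤)
    (b : DirectedAnosov.InnerProd V) (ρ : Γ →* DirectedAnosov.PGLin V)
    (hflat : ∃ C : ℝ, 0 < C ∧ ∀ η : ℕ → Γ, DirectedAnosov.IsRootedDirectedRay R η →
      ∃ F : Set (DirectedAnosov.X V), DirectedAnosov.IsMaximalFlat F ∧
        DirectedAnosov.IsBoundedFrom C F (fun i => ρ (η i) • DirectedAnosov.X.mk b))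
    (hroots : ∀ η : ℕ → Γ, DirectedAnosov.IsEscaping η → (∀ i, η i ∈ Submonoid.closure R) →
      ∀ k : Fin (Module.finrank ℝ V - 1),
        Filter.Tendsto
          (fun i => DirectedAnosov.simpleRoot k (DirectedAnosov.cartan b (ρ (η i))))
          Filter.atTop Filter.atTop) :
    DirectedAnosov.IsDirectedAnosov R b ρ := by
  obtain ⟨C, hC, hflat⟩ := hflat
  obtain ⟨D₀, hD₀⟩ := exists_cartan_sub_le hRfin b ρ
  -- `C + 1` leaves room for strict inequality in the distance to the flat. `D` bounds one step;
  -- `max` is there since `D₀` may be negative when it bounds an empty set.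
  set x := 4 * (C + 1) with hx
  set D := 2 * max D₀ 0 + 2 * x with hD
  have hD_nonneg : 0 ≤ D := by positivity
  -- Chosen so that doubling and subtracting the error `2 * x` leaves `D + 2`, more than one step
  -- can undo.
  obtain ⟨L₀, hL₀⟩ := exists_uniform_le_simpleRoot hroots (x + D / 2 + 1)
  set L := L₀ + 1 with hL
  -- The constants of `linear_growth` with `M = D + 2`, halved because log ratios are twice Cartan
  -- coordinates; `x` is half the comparison error.
  refine ⟨(D + 2) / L / 2, (D + 2 + L * D) / 2 + x, by positivity, by positivity, ?_⟩
  intro η hη k i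
  obtain ⟨F, hF, hηF⟩ := hflat η hη
  obtain ⟨e, c, hc⟩ := exists_diagonal_isCloseTo hF hηF
  let f : Fin (finrank ℝ V) → Fin (finrank ℝ V) → ℕ → ℝ := fun a a' i =>
    Real.log ((c i).form (e a) (e a)) - Real.log ((c i).form (e a') (e a'))
  have hf : ∀ i j, ∃ π : Equiv.Perm (Fin (finrank ℝ V)), ∀ k l,
      |2 * (cartan b (ρ ((η j)⁻¹ * η i)) k - cartan b (ρ ((η j)⁻¹ * η i)) l) -
        (f (π k) (π l) j - f (π k) (π l) i)| ≤ 2 * x := by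
    intro i j
    obtain ⟨π, hπ⟩ := exists_perm_abs_cartan_sub_le (hc i).1 (hc j).1 (hc i).2 (hc j).2
    refine ⟨π, fun k l => ?_⟩
    rw [map_mul, map_inv]
    convert hπ k l using 3
    simp only [f, logRatio]
    ring
  have hstep : ∀ a a' i, |f a a' (i + 1) - f a a' i| ≤ D := by
    intro a a' i
    obtain ⟨π, hπ⟩ := hf i (i + 1)
    have h1 := hπ (π.symm a) (π.symm a')
    rw [π.apply_symm_apply, π.apply_symm_apply] at h1
    have h2 := hD₀ ((η (i + 1))⁻¹ * η i) (by
      rw [mul_inv_rev, inv_inv]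
      refine hη.2.2.symm.imp (fun h => ?_) fun h => h i
      simpa using h i) (π.symm a) (π.symm a')
    have h3 := h2.trans (le_max_left D₀ 0)
    rw [abs_le] at h1 h3 ⊢
    constructor <;> linarith
  have hpair : ∀ a a' i j, a ≠ a' →
      (∀ k, x + D / 2 + 1 ≤ simpleRoot k (cartan b (ρ ((η j)⁻¹ * η i)))) →
      D + 2 ≤ |f a a' j - f a a' i| := by
    intro a a' i j ha h
    obtain ⟨π, hπ⟩ := hf i j
    have h1 := hπ (π.symm a) (π.symm a')
    rw [π.apply_symm_apply, π.apply_symm_apply, abs_le] at h1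
    rcases lt_or_gt_of_ne (π.symm.injective.ne ha) with hlt | hlt
    · have h2 := le_cartan_sub_of_le_simpleRoot h hlt
      refine le_trans ?_ (le_abs_self _)
      linarith
    · have h2 := le_cartan_sub_of_le_simpleRoot h hlt
      refine le_trans ?_ (neg_le_abs _)
      linarith
  have hgap : ∀ a a' i, a ≠ a' → D + 2 ≤ |f a a' (i + L) - f a a' i| := by
    intro a a' i ha
    have hw : L₀ ≤ wordDist R 1 ((η i)⁻¹ * η (i + L)) := by
      rw [wordDist_one_left, hη.1]; omega
    rcases hη.mem_closure i L with h | h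
    · rw [abs_sub_comm]
      exact hpair a a' _ _ ha (hL₀ _ h (Or.inl hw))
    · exact hpair a a' _ _ ha (hL₀ _ h (Or.inr (by simpa using hw)))
  -- The permutation depends on `i`. This is harmless: the growth estimate holds for every pair of
  -- distinct indices with the same constants.
  obtain ⟨π, hπ⟩ := hf i 0
  have h1 := hπ ⟨k, by omega⟩ ⟨k + 1, by omega⟩
  rw [show η 0 = 1 from hη.2.1, inv_one, one_mul, ← simpleRoot.eq_def] at h1
  have hne : π ⟨k, by omega⟩ ≠ π ⟨k + 1, by omega⟩ := π.injective.ne (by simp)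
  have h2 := linear_growth (L := L) (by omega) (hstep _ _) (fun i => hgap _ _ i hne)
    (by linarith) i
  have h3 := simpleRoot_cartan_nonneg b (ρ (η i)) k
  rw [abs_sub_comm] at h2
  have h4 : |f (π ⟨k, by omega⟩) (π ⟨k + 1, by omega⟩) 0 -
      f (π ⟨k, by omega⟩) (π ⟨k + 1, by omega⟩) i| ≤ 2 * simpleRoot k (cartan b (ρ (η i))) + 2 * x := by
    rw [abs_le] at h1 ⊢
    constructor <;> linarith
  have h5 := h2.trans h4
  linarith
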